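/- Let $f:\mathbb{R}^n\to(-\infty,+\infty]$ be a proper closed convex function, $K\in\mathbb{R}^{m\times n}$ and $b\in\mathbb{R}^m$, and assume that the Lagrangian $\mathcal{L}(x,y)=f(x)+\langle y,Kx\rangle-\langle b,y\rangle$ (minimized over $x\in\mathbb{R}^n$, maximized over $y\in\mathbb{R}^m$) has a saddle point. Let $\tau>0$, $\theta>0$, $\gamma\ge 3/4$, and put $Q=\gamma\tau KK^{\mathsf T}+\theta I_m$. Split $\mathbb{R}^m$ into $s$ consecutive blocks, write $Q=(Q_{i,j})_{1\le i,j\le s}$ and $y=(y_1,\dots,y_s)$ accordingly, and let $U$ be the strictly upper block triangular part of $Q$ (the blocks $Q_{i,j}$ with $i<j$). Suppose $U\ne 0$. Let $(x^0,y^0)\in\mathbb{R}^n\times\mathbb{R}^m$ be arbitrary and let $\{(x^k,y^k)\}$ be generated by eBALM-sGS: for $k\ge 0$, $$x^{k+1}=\mathrm{prox}_{\tau f}(x^k-\tau K^{\mathsf T}y^k)=\mathop{\mathrm{argmin}}_{z}\Big\{f(z)+\tfrac1{2\tau}\|z-(x^k-\tau K^{\mathsf T}y^k)\|^2\Big\},\qquad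 \bar b^{k+1}=K(2x^{k+1}-x^k)-b,$$ and $y^{k+1}$ is obtained by one block symmetric Gauss–Seidel sweep, started at $y^k$, for the linear system $Q(y-y^k)=\bar b^{k+1}$: $$\bar y_i^{k+1}=y_i^k+Q_{i,i}^{-1}\Big(\bar b_i^{k+1}-\sum_{j>i}Q_{i,j}(\bar y_j^{k+1}-y_j^k)\Big),\quad i=s,\dots,2,$$ $$y_i^{k+1}=y_i^k+Q_{i,i}^{-1}\Big(\bar b_i^{k+1}-\sum_{j<i}Q_{j,i}^{\mathsf T}(y_j^{k+1}-y_j^k)-\sum_{j>i}Q_{i,j}(\bar y_j^{k+1}-y_j^k)\Big),\quad i=1,\dots,s.$$ Then $(x^k,y^k)$ converges to a saddle point $(x^\star,y^\star)$ of $\mathcal{L}$, and $x^\star$ is an optimal solution of $\min f(x)$ s.t. $Kx=b$. Moreover, $\partial f(x^k)\neq\emptyset$ for all $k\ge1$, and, as $t\to\infty$, $$\min_{1\le k\le t}\mathrm{dist}(0,\partial f(x^k)+K^{\mathsf T}y^k)=o(1/\sqrt t),\qquad \min_{1\le k\le t}\mathrm{dist}(0,\partial f(x^k)+K^{\mathsf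 T}y^{k-1})=o(1/\sqrt t),\qquad \min_{1\le k\le t}\|Kx^k-b\|=o(1/\sqrt t).$$ If $\gamma\ge1$, then also $$\mathrm{dist}(0,\partial f(x^t)+K^{\mathsf T}y^t)=o(1/\sqrt t),\qquad \mathrm{dist}(0,\partial f(x^t)+K^{\mathsf T}y^{t-1})=o(1/\sqrt t),\qquad \|Kx^t-b\|=o(1/\sqrt t).$$ -/

import Mathlib

open Filter Topology Asymptotics

noncomputable section

namespace EBALM

/-! ### Convex analysis for extended-real-valued functions -/

/-- Proper closed convex functions with values in `(-∞, +∞]`. -/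
structure IsProperClosedConvex {E : Type*} [NormedAddCommGroup E] [InnerProductSpace ℝ E]
    (f : E → EReal) : Prop where
  ne_bot : ∀ x, f x ≠ ⊥
  exists_ne_top : ∃ x, f x ≠ ⊤
  lsc : LowerSemicontinuous f
  convex_epigraph : Convex ℝ {p : E × ℝ | f p.1 ≤ (p.2 : EReal)}

/-- The convex subdifferential (empty outside the effective domain). -/
def subdifferential {E : Type*} [NormedAddCommGroup E] [InnerProductSpace ℝ E]
    (f : E → EReal) (x : E) : Set E :=
  {ξ | f x ≠ ⊤ ∧ ∀ z, f x + ((inner ℝ ξ (z - x) : ℝ) : EReal) ≤ f z}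

/-- `p` is the proximal point of `v`, that is, a (hence the) minimizer of
`z ↦ f z + ‖z - v‖² / (2 τ)`. -/
def IsProx {E : Type*} [NormedAddCommGroup E] [InnerProductSpace ℝ E]
    (f : E → EReal) (τ : ℝ) (v p : E) : Prop :=
  ∀ z, f p + ((1 / (2 * τ) * ‖p - v‖ ^ 2 : ℝ) : EReal) ≤
    f z + ((1 / (2 * τ) * ‖z - v‖ ^ 2 : ℝ) : EReal)

section Problem

variable {ι κ : Type*} [Fintype ι] [Fintype κ]

/-- A real matrix acting on column vectors, with Euclidean norms on both sides. -/
def act (A : Matrix κ ι ℝ) (x : EuclideanSpace ℝ ι) : EuclideanSpace ℝ κ :=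
  WithLp.toLp 2 (A.mulVec x.ofLp)

/-- The Lagrangian `f(x) + ⟨y, K x⟩ - ⟨b, y⟩`. -/
def lagrangian (f : EuclideanSpace ℝ ι → EReal) (K : Matrix κ ι ℝ) (b : EuclideanSpace ℝ κ)
    (x : EuclideanSpace ℝ ι) (y : EuclideanSpace ℝ κ) : EReal :=
  f x + ((inner ℝ y (act K x) - inner ℝ b y : ℝ) : EReal)

/-- `(x, y)` is a saddle point of the Lagrangian (minimized in `x`, maximized in `y`). -/
def IsSaddlePoint (f : EuclideanSpace ℝ ι → EReal) (K : Matrix κ ι ℝ)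
    (b : EuclideanSpace ℝ κ) (x : EuclideanSpace ℝ ι) (y : EuclideanSpace ℝ κ) : Prop :=
  IsSaddlePointOn Set.univ Set.univ (lagrangian f K b) x y

/-- `x` is an optimal solution of `min f(x)` subject to `K x = b`. -/
def IsOptimalSolution (f : EuclideanSpace ℝ ι → EReal) (K : Matrix κ ι ℝ)
    (b : EuclideanSpace ℝ κ) (x : EuclideanSpace ℝ ι) : Prop :=
  act K x = b ∧ f x ≠ ⊤ ∧ ∀ z, act K z = b → f x ≤ f z

/-- The set `∂f(x) + Kᵀ y`. -/
def dualResidualSet (f : EuclideanSpace ℝ ι → EReal) (K : Matrix κ ι ℝ)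
    (x : EuclideanSpace ℝ ι) (y : EuclideanSpace ℝ κ) : Set (EuclideanSpace ℝ ι) :=
  (fun ξ => ξ + act K.transpose y) '' subdifferential f x

/-- `dist(0, ∂f(x) + Kᵀ y)`; meaningful where the subdifferential is nonempty. -/
def dualResidual (f : EuclideanSpace ℝ ι → EReal) (K : Matrix κ ι ℝ)
    (x : EuclideanSpace ℝ ι) (y : EuclideanSpace ℝ κ) : ℝ :=
  Metric.infDist 0 (dualResidualSet f K x y)

end Problem

/-- `min_{1 ≤ k ≤ t} r k` (for `t ≥ 1`). -/
def bestIterate (r : ℕ → ℝ) (t : ℕ) : ℝ := sInf (r '' Set.Icc 1 t)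

theorem isLeast_bestIterate (r : ℕ → ℝ) {t : ℕ} (ht : 1 ≤ t) :
    IsLeast (r '' Set.Icc 1 t) (bestIterate r t) := by
  have hne : (r '' Set.Icc 1 t).Nonempty := ⟨r 1, 1, ⟨le_refl 1, ht⟩, rfl⟩
  have hfin : (r '' Set.Icc 1 t).Finite := (Set.finite_Icc 1 t).image r
  exact ⟨hne.csInf_mem hfin, fun a ha => csInf_le hfin.bddBelow ha⟩

/-! ### Block structure of the dual variable and the symmetric Gauss–Seidel sweep

The dual space `ℝᵐ` is split into `s` consecutive blocks of sizes `m 0, …, m (s - 1)`. -/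

section Blocks

variable {s : ℕ} {m : Fin s → ℕ}

/-- The block `Q_{i,j}`. -/
def block (Q : Matrix ((i : Fin s) × Fin (m i)) ((i : Fin s) × Fin (m i)) ℝ) (i j : Fin s) :
    Matrix (Fin (m i)) (Fin (m j)) ℝ :=
  Matrix.of fun a c => Q ⟨i, a⟩ ⟨j, c⟩

/-- The block `y_i`. -/
def blockVec (y : EuclideanSpace ℝ ((i : Fin s) × Fin (m i))) (i : Fin s) : Fin (m i) → ℝ :=
  fun a => y ⟨i, a⟩

/-- The strictly upper block triangular part `U` of `Q`. -/
def strictUpper (Q : Matrix ((i : Fin s) × Fin (m i)) ((i : Fin s) × Fin (m i)) ℝ) :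
    Matrix ((i : Fin s) × Fin (m i)) ((i : Fin s) × Fin (m i)) ℝ :=
  Matrix.of fun p q => if p.1 < q.1 then Q p q else 0

/-- `Q = γ τ K Kᵀ + θ I`. -/
def dualMatrix {n : ℕ} (K : Matrix ((i : Fin s) × Fin (m i)) (Fin n) ℝ) (τ γ θ : ℝ) :
    Matrix ((i : Fin s) × Fin (m i)) ((i : Fin s) × Fin (m i)) ℝ :=
  (γ * τ) • (K * K.transpose) + θ • (1 : Matrix _ _ ℝ)

/-- `y'` is obtained from `y` by one block symmetric Gauss–Seidel sweep, started at `y`, for the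
linear system `Q (y' - y) = c`: a backward sweep over the blocks `s, …, 2` produces the
intermediate vector `w` (whose first block is never used), and a forward sweep over the blocks
`1, …, s` produces `y'`.  In the backward sweep the blocks `j < i` are still at their old values,
so their increments vanish. -/
def IsSGSSweep (Q : Matrix ((i : Fin s) × Fin (m i)) ((i : Fin s) × Fin (m i)) ℝ)
    (c y y' : EuclideanSpace ℝ ((i : Fin s) × Fin (m i))) : Prop :=
  ∃ w : EuclideanSpace ℝ ((i : Fin s) × Fin (m i)),
    (∀ i : Fin s, 0 < i.val →
      blockVec w i = blockVec y i + (block Q i i)⁻¹.mulVec (blockVec c i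
        - ∑ j ∈ Finset.univ.filter (fun j => i < j),
            (block Q i j).mulVec (blockVec w j - blockVec y j))) ∧
    (∀ i : Fin s,
      blockVec y' i = blockVec y i + (block Q i i)⁻¹.mulVec (blockVec c i
        - ∑ j ∈ Finset.univ.filter (fun j => j < i),
            (block Q j i).transpose.mulVec (blockVec y' j - blockVec y j)
        - ∑ j ∈ Finset.univ.filter (fun j => i < j),
            (block Q i j).mulVec (blockVec w j - blockVec y j)))

/-- The sequence `(x k, y k)` is generated by eBALM-sGS. -/
def IsEBALMsGS {n : ℕ} (f : EuclideanSpace ℝ (Fin n) → EReal)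
    (K : Matrix ((i : Fin s) × Fin (m i)) (Fin n) ℝ)
    (b : EuclideanSpace ℝ ((i : Fin s) × Fin (m i))) (τ γ θ : ℝ)
    (x : ℕ → EuclideanSpace ℝ (Fin n))
    (y : ℕ → EuclideanSpace ℝ ((i : Fin s) × Fin (m i))) : Prop :=
  ∀ k : ℕ,
    IsProx f τ (x k - τ • act K.transpose (y k)) (x (k + 1)) ∧
    IsSGSSweep (dualMatrix K τ γ θ) (act K ((2 : ℝ) • x (k + 1) - x k) - b) (y k) (y (k + 1))

end Blocks

end EBALM

end

noncomputable section

namespace EBALM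

/-! ### Convex analysis -/

section Convex

variable {E : Type*} [NormedAddCommGroup E] [InnerProductSpace ℝ E] {f : E → EReal}

/-! One symmetric Gauss–Seidel sweep solves `S (y' - y) = c` exactly, with `S = Q + U D⁻¹ Uᵀ ⪰ Q`
and `D` the block diagonal of `Q` (`IsSGSSweep.act_sgsMatrix`, `le_inner_sgsMatrix`). The algorithm
is therefore a primal-dual iteration with a dual preconditioner satisfying `S ⪰ γ τ K Kᵀ + θ I`;
only this bound and the symmetry of `S` matter afterwards.

Let `M(a, p) = ‖a‖²/τ - 2⟨K a, p⟩ + ⟨S p, p⟩`. Monotonicity of `∂f` makes `M`, taken at the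
deviation from a KKT point, drop by at least `M` of the step (`primalDualForm_step`). For `γ < 1`
the form `M` may be indefinite. Adding `½⟨K a, S⁻¹ K a⟩` repairs this: the decrease becomes `¼⟨r +
r', S⁻¹(r + r')⟩ + ‖d‖²/τ - ¾⟨K d, S⁻¹ K d⟩`, where `r`, `r'` are consecutive constraint residuals
and `d` is the primal step. It is coercive because `S ⪰ ¾ τ K Kᵀ + θ I` (`lyapunov_step`,
`exists_schur_bound`).

Telescoping makes steps and residuals square-summable, which gives the best-iterate rates.
Boundedness and the closed graph of `∂f` give a KKT cluster point, and the Lyapunov function centred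
there forces convergence of the whole sequence.

For `γ ≥ 1`, `M` is positive definite, and the same inequality applied to differences of consecutive
iterates shows that `M` of the steps is nonincreasing. Being also summable, it is `o(1/t)`, which
yields the last-iterate rates. -/

theorem IsProperClosedConvex.exists_coe (hf : IsProperClosedConvex f) {x : E} (hx : f x ≠ ⊤) :
    ∃ a : ℝ, f x = a :=
  ⟨(f x).toReal, (EReal.coe_toReal hx (hf.ne_bot x)).symm⟩

theorem subdifferential_mono (hf : IsProperClosedConvex f) {x z ξ η : E}
    (hξ : ξ ∈ subdifferential f x) (hη : η ∈ subdifferential f z) :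
    0 ≤ inner ℝ (ξ - η) (x - z) := by
  obtain ⟨hx, h1⟩ := hξ
  obtain ⟨hz, h2⟩ := hη
  obtain ⟨a, ha⟩ := hf.exists_coe hx
  obtain ⟨c, hc⟩ := hf.exists_coe hz
  have e1 := h1 z
  have e2 := h2 x
  rw [ha, hc] at e1 e2
  norm_cast at e1 e2
  have : inner ℝ ξ (z - x) = - inner ℝ ξ (x - z) := by rw [← inner_neg_right, neg_sub]
  rw [inner_sub_left]
  linarith

theorem IsProx.mem_subdifferential (hf : IsProperClosedConvex f) {τ : ℝ} (hτ : 0 < τ) {v p : E}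
    (h : IsProx f τ v p) : (1 / τ) • (v - p) ∈ subdifferential f p := by
  obtain ⟨z₀, hz₀⟩ := hf.exists_ne_top
  have hp : f p ≠ ⊤ := by
    intro hp
    obtain ⟨c, hc⟩ := hf.exists_coe hz₀
    have := h z₀
    rw [hp, hc, EReal.top_add_coe, ← EReal.coe_add, top_le_iff] at this
    exact EReal.coe_ne_top _ this
  refine ⟨hp, fun z => ?_⟩
  by_cases hz : f z = ⊤
  · rw [hz]; exact le_top
  obtain ⟨a, ha⟩ := hf.exists_coe hp
  obtain ⟨c, hc⟩ := hf.exists_coe hz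
  rw [ha, hc]
  norm_cast
  -- Comparing `p` with a point of the segment towards `z` and dividing by `t` leaves the
  -- subgradient inequality up to an `O(t)` error, which vanishes as `t → 0⁺`.
  have key : ∀ t : ℝ, 0 < t → t ≤ 1 →
      a + inner ℝ ((1 / τ) • (v - p)) (z - p) ≤ c + t * (1 / (2 * τ) * ‖z - p‖ ^ 2) := by
    intro t ht ht1
    have hmem := hf.convex_epigraph (x := (p, a)) (by simp [ha]) (y := (z, c)) (by simp [hc])
      (a := 1 - t) (b := t) (by linarith) ht.le (by ring)
    have hq : f ((1 - t) • p + t • z) ≤ (((1 - t) * a + t * c : ℝ) : EReal) := by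
      simpa using hmem
    have h1 := (h ((1 - t) • p + t • z)).trans (add_le_add_left hq _)
    rw [ha] at h1
    norm_cast at h1
    have e : (1 - t) • p + t • z - v = (p - v) + t • (z - p) := by module
    rw [e, norm_add_sq_real, inner_smul_right, norm_smul, Real.norm_eq_abs, mul_pow, sq_abs] at h1
    have e2 : inner ℝ ((1 / τ) • (v - p)) (z - p) = - (1 / τ * inner ℝ (p - v) (z - p)) := by
      rw [inner_smul_left, ← neg_sub p v, inner_neg_left]; simp
    rw [e2]
    set I := inner ℝ (p - v) (z - p)
    have e3 : 1 / (2 * τ) = 1 / τ / 2 := by field_simp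
    rw [e3] at h1 ⊢
    set q := 1 / τ
    have : t * (a + - (q * I)) ≤ t * (c + t * (q / 2 * ‖z - p‖ ^ 2)) := by nlinarith
    exact le_of_mul_le_mul_left this ht
  have hlim : Tendsto (fun t : ℝ => c + t * (1 / (2 * τ) * ‖z - p‖ ^ 2)) (𝓝[>] 0)
      (𝓝 (c + 0 * (1 / (2 * τ) * ‖z - p‖ ^ 2))) := by
    apply Tendsto.mono_left _ nhdsWithin_le_nhds
    exact (Continuous.tendsto (by fun_prop) 0)
  rw [zero_mul, add_zero] at hlim
  refine ge_of_tendsto hlim ?_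
  filter_upwards [Ioc_mem_nhdsGT (zero_lt_one' ℝ)] with t ht
  exact key t ht.1 ht.2

theorem subdifferential_closed (hf : IsProperClosedConvex f) {ι : Type*} {l : Filter ι} [l.NeBot]
    {x ξ : ι → E} {x₀ ξ₀ : E} (hx : Tendsto x l (𝓝 x₀)) (hξ : Tendsto ξ l (𝓝 ξ₀))
    (h : ∀ᶠ i in l, ξ i ∈ subdifferential f (x i)) : ξ₀ ∈ subdifferential f x₀ := by
  -- The inequality is rearranged with `f x₀` alone on the left, so that lower semicontinuity
  -- applies before `f x₀` is known to be finite; finiteness then follows by taking `z` in the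
  -- effective domain.
  have key : ∀ (z : E) (c : ℝ), f z = c → f x₀ ≤ ((c - inner ℝ ξ₀ (z - x₀) : ℝ) : EReal) := by
    intro z c hc
    refine le_of_forall_lt fun w hw => ?_
    obtain ⟨w', hw1, hw2⟩ := exists_between hw
    have hlim : Tendsto (fun i => ((c - inner ℝ (ξ i) (z - x i) : ℝ) : EReal)) l
        (𝓝 ((c - inner ℝ ξ₀ (z - x₀) : ℝ) : EReal)) :=
      (continuous_coe_real_ereal.tendsto _).comp
        (tendsto_const_nhds.sub (hξ.inner (tendsto_const_nhds.sub hx)))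
    refine hw1.trans_le (ge_of_tendsto hlim ?_)
    filter_upwards [h, hx.eventually (hf.lsc x₀ w' hw2)] with i hi hw'
    obtain ⟨a, ha⟩ := hf.exists_coe hi.1
    have := hi.2 z
    rw [ha, hc] at this
    norm_cast at this
    refine hw'.le.trans ?_
    rw [ha]
    norm_cast
    linarith
  obtain ⟨z₀, hz₀⟩ := hf.exists_ne_top
  have hx₀ : f x₀ ≠ ⊤ := by
    obtain ⟨c, hc⟩ := hf.exists_coe hz₀
    exact ((key z₀ c hc).trans_lt (EReal.coe_lt_top _)).ne
  refine ⟨hx₀, fun z => ?_⟩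
  by_cases hz : f z = ⊤
  · rw [hz]; exact le_top
  obtain ⟨a, ha⟩ := hf.exists_coe hx₀
  obtain ⟨c, hc⟩ := hf.exists_coe hz
  have := key z c hc
  rw [ha] at this
  rw [ha, hc]
  norm_cast at this ⊢
  linarith

end Convex

/-! ### Rates of decay of summable sequences -/

/-- The at least `t/2` terms with indices in `(t/2, t]` are all `≥ g t`, and their sum is a Cauchy
difference of partial sums. Monotonicity is asked only from index `1` because `bestIterate` has a
default value at `0`. -/
theorem tendsto_mul_of_antitone_of_summable {g : ℕ → ℝ} (hg0 : ∀ n, 0 ≤ g n)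
    (hanti : AntitoneOn g (Set.Ici 1)) (hsum : Summable g) :
    Tendsto (fun t : ℕ => (t : ℝ) * g t) atTop (𝓝 0) := by
  set σ : ℕ → ℝ := fun n => ∑ i ∈ Finset.range (n + 1), g i
  have hσ : Tendsto σ atTop (𝓝 (∑' i, g i)) :=
    hsum.hasSum.tendsto_sum_nat.comp (tendsto_add_atTop_nat 1)
  have hhalf : Tendsto (fun t : ℕ => t / 2) atTop atTop :=
    Nat.tendsto_div_const_atTop two_ne_zero
  have hlim : Tendsto (fun t : ℕ => 2 * (σ t - σ (t / 2))) atTop (𝓝 0) := by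
    have := (hσ.sub (hσ.comp hhalf)).const_mul 2
    simpa using this
  refine squeeze_zero (fun t => mul_nonneg t.cast_nonneg (hg0 t)) (fun t => ?_) hlim
  have h1 : σ t - σ (t / 2) = ∑ i ∈ Finset.Ico (t / 2 + 1) (t + 1), g i := by
    rw [Finset.sum_Ico_eq_sub _ (by omega)]
  have h2 : ((t - t / 2 : ℕ) : ℝ) * g t ≤ ∑ i ∈ Finset.Ico (t / 2 + 1) (t + 1), g i := by
    have := Finset.card_nsmul_le_sum (Finset.Ico (t / 2 + 1) (t + 1)) g (g t) (fun i hi => by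
      rw [Finset.mem_Ico] at hi
      exact hanti (Set.mem_Ici.2 (by omega)) (Set.mem_Ici.2 (by omega)) (by omega))
    have hcard : t + 1 - (t / 2 + 1) = t - t / 2 := by omega
    rwa [Nat.card_Ico, nsmul_eq_mul, hcard] at this
  have h3 : (t : ℝ) ≤ 2 * ((t - t / 2 : ℕ) : ℝ) := by
    have : t ≤ 2 * (t - t / 2) := by omega
    exact_mod_cast this
  rw [h1]
  calc (t : ℝ) * g t ≤ 2 * ((t - t / 2 : ℕ) : ℝ) * g t := mul_le_mul_of_nonneg_right h3 (hg0 t)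
    _ = 2 * (((t - t / 2 : ℕ) : ℝ) * g t) := by ring
    _ ≤ _ := by linarith

theorem isLittleO_one_div_sqrt {r : ℕ → ℝ}
    (hr : Tendsto (fun t : ℕ => (t : ℝ) * r t ^ 2) atTop (𝓝 0)) :
    r =o[atTop] fun t : ℕ => 1 / Real.sqrt t := by
  refine (isLittleO_iff_tendsto' ?_).2 ?_
  · filter_upwards [eventually_gt_atTop 0] with t ht h
    have : 0 < 1 / Real.sqrt t := by positivity
    exact absurd h this.ne'
  · have h1 : Tendsto (fun t : ℕ => Real.sqrt ((t : ℝ) * r t ^ 2)) atTop (𝓝 0) := by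
      simpa using hr.sqrt
    refine (tendsto_zero_iff_abs_tendsto_zero _).2 (h1.congr fun t => ?_)
    rw [Real.sqrt_mul t.cast_nonneg, Real.sqrt_sq_eq_abs, Function.comp_apply, div_div_eq_mul_div,
      div_one, abs_mul, abs_of_nonneg (Real.sqrt_nonneg _), mul_comm]

theorem bestIterate_isLittleO {r : ℕ → ℝ} (hr : ∀ k, 0 ≤ r k) (hs : Summable fun k => r k ^ 2) :
    bestIterate r =o[atTop] fun t : ℕ => 1 / Real.sqrt t := by
  have h0 : ∀ t, 0 ≤ bestIterate r t := fun t => by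
    apply Real.sInf_nonneg
    rintro _ ⟨k, -, rfl⟩
    exact hr k
  have hle : ∀ t, bestIterate r t ≤ r t := fun t => by
    -- At `t = 0` the infimum is over the empty set and equals `0`.
    rcases Nat.eq_zero_or_pos t with rfl | ht
    · simpa [bestIterate] using hr 0
    · exact (isLeast_bestIterate r ht).2 ⟨t, ⟨ht, le_rfl⟩, rfl⟩
  refine isLittleO_one_div_sqrt (tendsto_mul_of_antitone_of_summable (fun t => sq_nonneg _) ?_ ?_)
  · intro a ha c hc hac
    refine pow_le_pow_left₀ (h0 _) ?_ 2
    obtain ⟨k, hk, hk'⟩ := (isLeast_bestIterate r (Set.mem_Ici.1 ha)).1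
    rw [← hk']
    exact (isLeast_bestIterate r (Set.mem_Ici.1 hc)).2 ⟨k, ⟨hk.1, hk.2.trans hac⟩, rfl⟩
  · exact hs.of_nonneg_of_le (fun t => sq_nonneg _) fun t => pow_le_pow_left₀ (h0 t) (hle t) 2

/-! ### Square-summable and `o(1/√t)` sequences in normed spaces -/

section Sequences

variable {E F : Type*} [NormedAddCommGroup E] [NormedAddCommGroup F]

theorem norm_add_sq_le_two_mul (u v : E) : ‖u + v‖ ^ 2 ≤ 2 * (‖u‖ ^ 2 + ‖v‖ ^ 2) := by
  have h := norm_add_le u v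
  nlinarith [norm_nonneg (u + v), sq_nonneg (‖u‖ - ‖v‖), norm_nonneg u, norm_nonneg v]

theorem norm_clm_sq_le [NormedSpace ℝ E] [NormedSpace ℝ F] (L : E →L[ℝ] F) (u : E) :
    ‖L u‖ ^ 2 ≤ ‖L‖ ^ 2 * ‖u‖ ^ 2 := by
  rw [← mul_pow]
  exact pow_le_pow_left₀ (norm_nonneg _) (L.le_opNorm u) 2

theorem summable_norm_sq_add {u v : ℕ → E} (hu : Summable fun k => ‖u k‖ ^ 2)
    (hv : Summable fun k => ‖v k‖ ^ 2) : Summable fun k => ‖u k + v k‖ ^ 2 :=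
  ((hu.add hv).mul_left 2).of_nonneg_of_le (fun _ => sq_nonneg _)
    fun _ => norm_add_sq_le_two_mul _ _

theorem summable_norm_sq_clm [NormedSpace ℝ E] [NormedSpace ℝ F] (L : E →L[ℝ] F) {u : ℕ → E}
    (hu : Summable fun k => ‖u k‖ ^ 2) :
    Summable fun k => ‖L (u k)‖ ^ 2 :=
  (hu.mul_left (‖L‖ ^ 2)).of_nonneg_of_le (fun _ => sq_nonneg _) fun _ => norm_clm_sq_le L _

theorem tendsto_mul_norm_sq_add {u v : ℕ → E}
    (hu : Tendsto (fun t : ℕ => (t : ℝ) * ‖u t‖ ^ 2) atTop (𝓝 0))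
    (hv : Tendsto (fun t : ℕ => (t : ℝ) * ‖v t‖ ^ 2) atTop (𝓝 0)) :
    Tendsto (fun t : ℕ => (t : ℝ) * ‖u t + v t‖ ^ 2) atTop (𝓝 0) := by
  have h : Tendsto (fun t : ℕ => 2 * ((t : ℝ) * ‖u t‖ ^ 2 + (t : ℝ) * ‖v t‖ ^ 2)) atTop (𝓝 0) := by
    simpa using (hu.add hv).const_mul 2
  refine squeeze_zero (fun t => by positivity) (fun t => ?_) h
  have := mul_le_mul_of_nonneg_left (norm_add_sq_le_two_mul (u t) (v t)) (t.cast_nonneg (α := ℝ))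
  linarith

theorem tendsto_mul_norm_sq_clm [NormedSpace ℝ E] [NormedSpace ℝ F] (L : E →L[ℝ] F)
    {u : ℕ → E}
    (hu : Tendsto (fun t : ℕ => (t : ℝ) * ‖u t‖ ^ 2) atTop (𝓝 0)) :
    Tendsto (fun t : ℕ => (t : ℝ) * ‖L (u t)‖ ^ 2) atTop (𝓝 0) := by
  have h : Tendsto (fun t : ℕ => ‖L‖ ^ 2 * ((t : ℝ) * ‖u t‖ ^ 2)) atTop (𝓝 0) := by
    simpa using hu.const_mul (‖L‖ ^ 2)
  refine squeeze_zero (fun t => by positivity) (fun t => ?_) h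
  have := mul_le_mul_of_nonneg_left (norm_clm_sq_le L (u t)) (t.cast_nonneg (α := ℝ))
  linarith

theorem tendsto_mul_norm_sq_of_succ {u : ℕ → E}
    (hu : Tendsto (fun t : ℕ => (t : ℝ) * ‖u (t + 1)‖ ^ 2) atTop (𝓝 0)) :
    Tendsto (fun t : ℕ => (t : ℝ) * ‖u t‖ ^ 2) atTop (𝓝 0) := by
  refine (tendsto_add_atTop_iff_nat 1).1 ?_
  have h : Tendsto (fun t : ℕ => 2 * ((t : ℝ) * ‖u (t + 1)‖ ^ 2)) atTop (𝓝 0) := by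
    simpa using hu.const_mul 2
  refine squeeze_zero' (.of_forall fun t => by positivity) ?_ h
  filter_upwards [eventually_ge_atTop 1] with t ht
  have : (1 : ℝ) ≤ t := by exact_mod_cast ht
  push_cast
  nlinarith [sq_nonneg ‖u (t + 1)‖]

theorem tendsto_zero_of_norm_sq_le {c : ℝ} {u : ℕ → E} {V : ℕ → ℝ} (hc : 0 < c)
    (hle : ∀ k, c * ‖u k‖ ^ 2 ≤ V k) (hV : Tendsto V atTop (𝓝 0)) : Tendsto u atTop (𝓝 0) := by
  rw [tendsto_zero_iff_norm_tendsto_zero]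
  have h : Tendsto (fun k => Real.sqrt (c⁻¹ * V k)) atTop (𝓝 0) := by
    simpa using (hV.const_mul c⁻¹).sqrt
  refine squeeze_zero (fun _ => norm_nonneg _) (fun k => Real.le_sqrt_of_sq_le ?_) h
  rw [le_inv_mul_iff₀ hc]
  exact hle k

theorem tendsto_zero_of_summable_norm_sq {u : ℕ → E} (hu : Summable fun k => ‖u k‖ ^ 2) :
    Tendsto u atTop (𝓝 0) :=
  tendsto_zero_of_norm_sq_le one_pos (fun _ => (one_mul _).le) hu.tendsto_atTop_zero

theorem summable_of_descent {V δ : ℕ → ℝ} (hV : ∀ k, 0 ≤ V k) (hδ : ∀ k, 0 ≤ δ k)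
    (h : ∀ k, V (k + 1) ≤ V k - δ k) : Summable δ := by
  refine summable_of_sum_range_le (c := V 0) hδ fun n => ?_
  have : ∑ i ∈ Finset.range n, δ i ≤ V 0 - V n := by
    induction n with
    | zero => simp
    | succ n ih => rw [Finset.sum_range_succ]; linarith [h n]
  linarith [hV n]

end Sequences

/-! ### The energy of a primal-dual iteration with a dual preconditioner -/

section Energy

variable {X Y : Type*} [NormedAddCommGroup X] [InnerProductSpace ℝ X]
  [NormedAddCommGroup Y] [InnerProductSpace ℝ Y]

/-- The quadratic form `‖a‖² / τ - 2 ⟨A a, p⟩ + ⟨S p, p⟩`. -/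
def primalDualForm (A : X →L[ℝ] Y) (S : Y →L[ℝ] Y) (τ : ℝ) (a : X) (p : Y) : ℝ :=
  1 / τ * ‖a‖ ^ 2 - 2 * inner ℝ (A a) p + inner ℝ (S p) p

/-- The Lyapunov function: the primal-dual form corrected by half the squared constraint residual
in the metric of the inverse preconditioner `T`. -/
def lyapunov (A : X →L[ℝ] Y) (S T : Y →L[ℝ] Y) (τ : ℝ) (a : X) (p : Y) : ℝ :=
  primalDualForm A S τ a p + 1 / 2 * inner ℝ (A a) (T (A a))

variable {A : X →L[ℝ] Y} {B : Y →L[ℝ] X} {S T : Y →L[ℝ] Y} {τ θ : ℝ}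

/-- For a symmetric form, `M(z') = M(z) - M(z' - z) + 2⟨M(z' - z), z'⟩`; the extrapolation `2a' - a`
in `hp` makes the cross term exactly minus twice the inner product in `hw`. The lemma serves twice:
for deviations from a KKT point and for differences of consecutive iterates, where `b` cancels. -/
theorem primalDualForm_step (hAB : ∀ x y, inner ℝ (A x) y = inner ℝ x (B y))
    (hS : ∀ u v, inner ℝ (S u) v = inner ℝ u (S v)) {a a' : X} {p p' : Y}
    (hp : S (p' - p) = A ((2 : ℝ) • a' - a))
    (hw : 0 ≤ inner ℝ (-B p - (1 / τ) • (a' - a)) a') :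
    primalDualForm A S τ a' p' ≤
      primalDualForm A S τ a p - primalDualForm A S τ (a' - a) (p' - p) := by
  obtain ⟨e, rfl⟩ : ∃ e, p' = p + e := ⟨p' - p, by abel⟩
  obtain ⟨d, rfl⟩ : ∃ d, a' = a + d := ⟨a' - a, by abel⟩
  rw [add_sub_cancel_left] at hp
  have h1 : inner ℝ (S e) p = inner ℝ (A a) p + 2 * inner ℝ (A d) p := by
    rw [hp]
    simp only [map_sub, map_smul, map_add, inner_sub_left, inner_smul_left, inner_add_left]
    simp
    ring
  have h2 : inner ℝ (S e) e = inner ℝ (A a) e + 2 * inner ℝ (A d) e := by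
    conv_lhs => rw [hp]
    simp only [map_sub, map_smul, map_add, inner_sub_left, inner_smul_left, inner_add_left]
    simp
    ring
  have h3 : inner ℝ (S p) e = inner ℝ (S e) p := by rw [hS, real_inner_comm]
  have h4 : inner ℝ (B p) a = inner ℝ (A a) p := by rw [hAB, real_inner_comm]
  have h5 : inner ℝ (B p) d = inner ℝ (A d) p := by rw [hAB, real_inner_comm]
  simp only [add_sub_cancel_left, inner_sub_left, inner_neg_left, inner_add_right,
    inner_smul_left, real_inner_self_eq_norm_sq, h4, h5] at hw
  simp only [primalDualForm, add_sub_cancel_left, map_add, inner_add_left, inner_add_right, h3, h1,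
    h2, norm_add_sq_real]
  simp only [conj_trivial] at hw
  have h6 : inner ℝ d a = inner ℝ a d := real_inner_comm _ _
  rw [h6] at hw
  linarith

theorem inverse_symm (hS : ∀ u v, inner ℝ (S u) v = inner ℝ u (S v)) (hST : ∀ u, S (T u) = u)
    (u v : Y) : inner ℝ u (T v) = inner ℝ v (T u) := by
  conv_lhs => rw [← hST u, hS, hST, real_inner_comm]

theorem inverse_apply (hS : ∀ u v, inner ℝ (S u) v = inner ℝ u (S v)) (hST : ∀ u, S (T u) = u)
    (u : Y) : T (S u) = u := by
  refine ext_inner_right ℝ fun v => ?_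
  rw [real_inner_comm, inverse_symm hS hST, hS, hST]

/-- Eliminating the dual step through `T` leaves only `T`-products of `u = A a` and `u' = A a'`. The
constants come from `2⟨u, u'⟩ - ½|u|² - ½|u'|² = ¼|u + u'|² - ¾|u' - u|²`; this is where the
threshold `3/4` originates. -/
theorem lyapunov_step (hAB : ∀ x y, inner ℝ (A x) y = inner ℝ x (B y))
    (hS : ∀ u v, inner ℝ (S u) v = inner ℝ u (S v)) (hST : ∀ u, S (T u) = u)
    {a a' : X} {p p' : Y} (hp : S (p' - p) = A ((2 : ℝ) • a' - a))
    (hw : 0 ≤ inner ℝ (-B p - (1 / τ) • (a' - a)) a') :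
    lyapunov A S T τ a' p' ≤ lyapunov A S T τ a p
      - (1 / 4 * inner ℝ (A a + A a') (T (A a + A a'))
        + (1 / τ * ‖a' - a‖ ^ 2 - 3 / 4 * inner ℝ (A (a' - a)) (T (A (a' - a))))) := by
  have h := primalDualForm_step hAB hS hp hw
  have he : p' - p = T (A ((2 : ℝ) • a' - a)) := by rw [← hp, inverse_apply hS hST]
  have h1 : primalDualForm A S τ (a' - a) (p' - p) =
      1 / τ * ‖a' - a‖ ^ 2 + 2 * inner ℝ (A a) (T (A a')) - inner ℝ (A a) (T (A a)) := by
    rw [primalDualForm, hp, he]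
    simp only [map_sub, map_smul, inner_sub_left, inner_sub_right, inner_smul_left,
      inner_smul_right, conj_trivial, inverse_symm hS hST (A a') (A a)]
    ring
  rw [h1] at h
  simp only [lyapunov, map_sub, map_add, inner_sub_left, inner_sub_right, inner_add_left,
    inner_add_right, inverse_symm hS hST (A a') (A a)]
  linarith

theorem exists_inverse [FiniteDimensional ℝ Y] (hθ : 0 < θ)
    (h : ∀ u, θ * ‖u‖ ^ 2 ≤ inner ℝ (S u) u) : ∃ T : Y →L[ℝ] Y, ∀ u, S (T u) = u := by
  have hinj : Function.Injective (S : Y →ₗ[ℝ] Y) := by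
    rw [← LinearMap.ker_eq_bot, LinearMap.ker_eq_bot']
    intro u hu
    have h1 := h u
    rw [ContinuousLinearMap.coe_coe] at hu
    rw [hu, inner_zero_left] at h1
    have : ‖u‖ ^ 2 = 0 := le_antisymm (nonpos_of_mul_nonpos_right h1 hθ) (sq_nonneg _)
    simpa using this
  refine ⟨LinearMap.toContinuousLinearMap
    (LinearEquiv.ofInjectiveEndo (S : Y →ₗ[ℝ] Y) hinj).symm.toLinearMap, fun u => ?_⟩
  exact (LinearEquiv.ofInjectiveEndo (S : Y →ₗ[ℝ] Y) hinj).apply_symm_apply u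

/-- Coercivity at `T u` gives `⟨u, T u⟩ ≥ θ‖T u‖²`, and `‖u‖ ≤ ‖S‖‖T u‖`. The `+ 1` keeps the
denominator positive. -/
theorem inverse_lower_bound (hST : ∀ u, S (T u) = u) (hθ : 0 < θ)
    (h : ∀ u, θ * ‖u‖ ^ 2 ≤ inner ℝ (S u) u) (u : Y) :
    θ / (‖S‖ ^ 2 + 1) * ‖u‖ ^ 2 ≤ inner ℝ u (T u) := by
  have h1 := h (T u)
  have h2 := norm_clm_sq_le S (T u)
  rw [hST] at h1 h2
  rw [div_mul_eq_mul_div, div_le_iff₀ (by positivity)]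
  nlinarith [sq_nonneg ‖S‖, sq_nonneg ‖T u‖]

/-- The preconditioned operator `Aᵀ T A` is uniformly smaller than `4 / (3 τ)`. -/
theorem exists_schur_bound (hAB : ∀ x y, inner ℝ (A x) y = inner ℝ x (B y))
    (hST : ∀ u, S (T u) = u) (hτ : 0 < τ) (hθ : 0 < θ)
    (h : ∀ u, 3 / 4 * τ * ‖B u‖ ^ 2 + θ * ‖u‖ ^ 2 ≤ inner ℝ (S u) u) :
    ∃ ε > 0, ∀ d, 3 / 4 * inner ℝ (A d) (T (A d)) ≤ (1 / τ - ε) * ‖d‖ ^ 2 := by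
  -- Part of `θ‖u‖²` is traded for a multiple of `‖B u‖²`, pushing the coefficient strictly above
  -- `3τ/4`; this surplus is what makes `ε` positive.
  set β := 3 / 4 * τ + θ / (‖B‖ ^ 2 + 1) with hβ
  have hpos : 0 < θ / (‖B‖ ^ 2 + 1) := by positivity
  have hβ0 : 0 < β := by positivity
  refine ⟨1 / τ - 3 / 4 / β, ?_, fun d => ?_⟩
  · rw [gt_iff_lt, sub_pos, div_lt_div_iff₀ hβ0 hτ]
    linarith
  set g := T (A d)
  have h1 : β * ‖B g‖ ^ 2 ≤ inner ℝ (A d) g := by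
    have h2 := h g
    rw [hST] at h2
    have h3 : θ / (‖B‖ ^ 2 + 1) * ‖B g‖ ^ 2 ≤ θ * ‖g‖ ^ 2 := by
      rw [div_mul_eq_mul_div, div_le_iff₀ (by positivity)]
      nlinarith [norm_clm_sq_le B g, sq_nonneg ‖g‖]
    rw [hβ, add_mul]
    linarith
  have h2 : inner ℝ (A d) g ≤ ‖d‖ * ‖B g‖ := by
    rw [hAB]; exact real_inner_le_norm _ _
  have h3 : β * inner ℝ (A d) g ≤ ‖d‖ ^ 2 := by
    nlinarith [sq_nonneg (‖d‖ - β * ‖B g‖)]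
  rw [sub_sub_cancel, div_mul_eq_mul_div (3 / 4) β, le_div_iff₀ hβ0]
  linarith

/-- Completing the square in `p` around `T (A a)` costs `⟨A a, T (A a)⟩`, of which the correction
returns half. The other half is at most `2/(3τ)‖a‖²`, leaving `1/(3τ)`. -/
theorem lyapunov_lower_bound (hS : ∀ u v, inner ℝ (S u) v = inner ℝ u (S v))
    (hST : ∀ u, S (T u) = u) (hτ : 0 < τ) (h : ∀ u, θ * ‖u‖ ^ 2 ≤ inner ℝ (S u) u)
    {ε : ℝ} (hε : 0 < ε) (hA : ∀ d, 3 / 4 * inner ℝ (A d) (T (A d)) ≤ (1 / τ - ε) * ‖d‖ ^ 2)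
    (a : X) (p : Y) :
    1 / (3 * τ) * ‖a‖ ^ 2 + θ * ‖p - T (A a)‖ ^ 2 ≤ lyapunov A S T τ a p := by
  have h1 := h (p - T (A a))
  have h2 := hA a
  rw [map_sub, hST, inner_sub_left, inner_sub_right, inner_sub_right, hS p (T (A a)), hST,
    real_inner_comm (A a) p] at h1
  rw [lyapunov, primalDualForm]
  have : 1 / (3 * τ) = 1 / 3 * (1 / τ) := by field_simp
  rw [this]
  nlinarith [mul_nonneg hε.le (sq_nonneg ‖a‖)]

theorem primalDualForm_lower_bound (hAB : ∀ x y, inner ℝ (A x) y = inner ℝ x (B y)) (hτ : 0 < τ)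
    (h : ∀ u, τ * ‖B u‖ ^ 2 + θ * ‖u‖ ^ 2 ≤ inner ℝ (S u) u) (a : X) (p : Y) :
    1 / τ * ‖a - τ • B p‖ ^ 2 + θ * ‖p‖ ^ 2 ≤ primalDualForm A S τ a p := by
  have h1 := h p
  rw [primalDualForm, hAB, norm_sub_sq_real, inner_smul_right, norm_smul, Real.norm_eq_abs,
    mul_pow, sq_abs]
  have : 1 / τ * (‖a‖ ^ 2 - 2 * (τ * inner ℝ a (B p)) + τ ^ 2 * ‖B p‖ ^ 2) =
      1 / τ * ‖a‖ ^ 2 - 2 * inner ℝ a (B p) + τ * ‖B p‖ ^ 2 := by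
    field_simp
  rw [this]
  linarith

theorem primalDualForm_le (a : X) (p : Y) : primalDualForm A S τ a p ≤
    1 / τ * ‖a‖ ^ 2 + ‖A a‖ ^ 2 + (1 + ‖S‖) * ‖p‖ ^ 2 := by
  have h1 : -inner ℝ (A a) p ≤ ‖A a‖ * ‖p‖ := by
    rw [← inner_neg_left, ← norm_neg (A a)]; exact real_inner_le_norm _ _
  have h2 : inner ℝ (S p) p ≤ ‖S‖ * ‖p‖ ^ 2 := by
    have := (real_inner_le_norm (S p) p).trans
      (mul_le_mul_of_nonneg_right (S.le_opNorm p) (norm_nonneg p))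
    linarith
  rw [primalDualForm]
  nlinarith [sq_nonneg (‖A a‖ - ‖p‖)]

end Energy

/-! ### Convergence of the preconditioned primal-dual iteration -/

section Iteration

variable {X Y : Type*} [NormedAddCommGroup X] [InnerProductSpace ℝ X]
  [NormedAddCommGroup Y] [InnerProductSpace ℝ Y]

/-- The optimality conditions of `min f(x)` subject to `A x = b`; here `B` is the adjoint of `A`. -/
def IsKKT (f : X → EReal) (A : X →L[ℝ] Y) (B : Y →L[ℝ] X) (b : Y) (x : X) (y : Y) : Prop :=
  A x = b ∧ -B y ∈ subdifferential f x

/-- A proximal step in `x` followed by a dual step preconditioned by `S`. -/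
structure IsPrimalDualIteration (f : X → EReal) (A : X →L[ℝ] Y) (B : Y →L[ℝ] X) (S : Y →L[ℝ] Y)
    (b : Y) (τ : ℝ) (x : ℕ → X) (y : ℕ → Y) : Prop where
  adjoint : ∀ x y, inner ℝ (A x) y = inner ℝ x (B y)
  symm : ∀ u v, inner ℝ (S u) v = inner ℝ u (S v)
  subgradient : ∀ k, -B (y k) - (1 / τ) • (x (k + 1) - x k) ∈ subdifferential f (x (k + 1))
  dual : ∀ k, S (y (k + 1) - y k) = A ((2 : ℝ) • x (k + 1) - x k) - b

variable {f : X → EReal} {A : X →L[ℝ] Y} {B : Y →L[ℝ] X} {S T : Y →L[ℝ] Y} {b : Y} {τ θ : ℝ}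
  {x : ℕ → X} {y : ℕ → Y}

namespace IsPrimalDualIteration

theorem lyapunov_descent (h : IsPrimalDualIteration f A B S b τ x y)
    (hf : IsProperClosedConvex f) (hST : ∀ u, S (T u) = u) {xs : X} {ys : Y}
    (hs : IsKKT f A B b xs ys) {ε : ℝ}
    (hA : ∀ d, 3 / 4 * inner ℝ (A d) (T (A d)) ≤ (1 / τ - ε) * ‖d‖ ^ 2) (k : ℕ) :
    lyapunov A S T τ (x (k + 1) - xs) (y (k + 1) - ys) ≤ lyapunov A S T τ (x k - xs) (y k - ys)
      - (1 / 4 * inner ℝ ((A (x k) - b) + (A (x (k + 1)) - b))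
          (T ((A (x k) - b) + (A (x (k + 1)) - b))) + ε * ‖x (k + 1) - x k‖ ^ 2) := by
  have h1 : S ((y (k + 1) - ys) - (y k - ys)) =
      A ((2 : ℝ) • (x (k + 1) - xs) - (x k - xs)) := by
    rw [sub_sub_sub_cancel_right, h.dual, ← hs.1, ← map_sub]
    congr 1
    module
  have h2 : 0 ≤ inner ℝ (-B (y k - ys) - (1 / τ) • ((x (k + 1) - xs) - (x k - xs)))
      (x (k + 1) - xs) := by
    have := subdifferential_mono hf (h.subgradient k) hs.2
    convert this using 2
    rw [sub_sub_sub_cancel_right, map_sub]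
    abel
  have h3 := lyapunov_step h.adjoint h.symm hST h1 h2
  have h4 := hA (x (k + 1) - x k)
  rw [sub_sub_sub_cancel_right, map_sub A (x k) xs, map_sub A (x (k + 1)) xs, hs.1] at h3
  linarith

theorem lyapunov_antitone (h : IsPrimalDualIteration f A B S b τ x y)
    (hf : IsProperClosedConvex f) (hST : ∀ u, S (T u) = u) (hθ : 0 < θ)
    (hS : ∀ u, θ * ‖u‖ ^ 2 ≤ inner ℝ (S u) u) {ε : ℝ} (hε : 0 < ε)
    (hA : ∀ d, 3 / 4 * inner ℝ (A d) (T (A d)) ≤ (1 / τ - ε) * ‖d‖ ^ 2) {xs : X} {ys : Y}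
    (hs : IsKKT f A B b xs ys) :
    Antitone fun k => lyapunov A S T τ (x k - xs) (y k - ys) := by
  refine antitone_nat_of_succ_le fun k => ?_
  have h1 := h.lyapunov_descent hf hST hs hA k
  have h2 := inverse_lower_bound hST hθ hS ((A (x k) - b) + (A (x (k + 1)) - b))
  have h3 : 0 ≤ θ / (‖S‖ ^ 2 + 1) * ‖(A (x k) - b) + (A (x (k + 1)) - b)‖ ^ 2 := by positivity
  have h4 : 0 ≤ ε * ‖x (k + 1) - x k‖ ^ 2 := by positivity
  linarith

theorem summable_steps (h : IsPrimalDualIteration f A B S b τ x y)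
    (hf : IsProperClosedConvex f) (hST : ∀ u, S (T u) = u) (hτ : 0 < τ) (hθ : 0 < θ)
    (hS : ∀ u, θ * ‖u‖ ^ 2 ≤ inner ℝ (S u) u) {ε : ℝ} (hε : 0 < ε)
    (hA : ∀ d, 3 / 4 * inner ℝ (A d) (T (A d)) ≤ (1 / τ - ε) * ‖d‖ ^ 2)
    (hsol : ∃ xs ys, IsKKT f A B b xs ys) :
    (Summable fun k => ‖x (k + 1) - x k‖ ^ 2) ∧ (Summable fun k => ‖y (k + 1) - y k‖ ^ 2) ∧
    (Summable fun k => ‖A (x k) - b‖ ^ 2) := by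
  obtain ⟨xs, ys, hs⟩ := hsol
  set c := θ / (‖S‖ ^ 2 + 1)
  have hc : 0 < c := by positivity
  have hsum : Summable fun k => 1 / 4 * (c * ‖(A (x k) - b) + (A (x (k + 1)) - b)‖ ^ 2)
      + ε * ‖x (k + 1) - x k‖ ^ 2 := by
    refine summable_of_descent (V := fun k => lyapunov A S T τ (x k - xs) (y k - ys))
      (fun k => le_trans (by positivity) (lyapunov_lower_bound h.symm hST hτ hS hε hA _ _))
      (fun k => by positivity) fun k => ?_
    refine (h.lyapunov_descent hf hST hs hA k).trans ?_
    linarith [inverse_lower_bound hST hθ hS ((A (x k) - b) + (A (x (k + 1)) - b))]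
  have hd : Summable fun k => ‖x (k + 1) - x k‖ ^ 2 := by
    refine (hsum.mul_left ε⁻¹).of_nonneg_of_le (fun _ => sq_nonneg _) fun k => ?_
    rw [le_inv_mul_iff₀ hε]
    have : 0 ≤ 1 / 4 * (c * ‖(A (x k) - b) + (A (x (k + 1)) - b)‖ ^ 2) := by positivity
    linarith
  have hrr : Summable fun k => ‖(A (x k) - b) + (A (x (k + 1)) - b)‖ ^ 2 := by
    refine (hsum.mul_left (4 * c⁻¹)).of_nonneg_of_le (fun _ => sq_nonneg _) fun k => ?_
    have : 0 ≤ ε * ‖x (k + 1) - x k‖ ^ 2 := by positivity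
    rw [mul_comm 4, mul_assoc, le_inv_mul_iff₀ hc]
    linarith
  have hr : Summable fun k => ‖A (x k) - b‖ ^ 2 := by
    -- The sum of consecutive residuals minus `A` of the primal step is twice the current residual.
    have h1 := summable_norm_sq_add hrr (summable_norm_sq_clm (-A) hd)
    have h2 := summable_norm_sq_clm ((1 / 2 : ℝ) • ContinuousLinearMap.id ℝ Y) h1
    refine h2.congr fun k => ?_
    congr 2
    simp only [neg_apply, map_sub, smul_apply,
      ContinuousLinearMap.id_apply]
    module
  have he : Summable fun k => ‖y (k + 1) - y k‖ ^ 2 := by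
    -- The right-hand side of the dual equation is the residual at `x k` plus twice `A` of the
    -- primal step.
    have h1 := summable_norm_sq_add hr (summable_norm_sq_clm ((2 : ℝ) • A) hd)
    refine (summable_norm_sq_clm T h1).congr fun k => ?_
    rw [← inverse_apply h.symm hST (y (k + 1) - y k), h.dual]
    congr 3
    simp only [map_sub, smul_apply, map_smul]
    module
  exact ⟨hd, he, hr⟩

variable [FiniteDimensional ℝ X] [FiniteDimensional ℝ Y]

theorem exists_subseq_tendsto_isKKT (h : IsPrimalDualIteration f A B S b τ x y)
    (hf : IsProperClosedConvex f) (hST : ∀ u, S (T u) = u) (hτ : 0 < τ) (hθ : 0 < θ)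
    (hS : ∀ u, θ * ‖u‖ ^ 2 ≤ inner ℝ (S u) u) {ε : ℝ} (hε : 0 < ε)
    (hA : ∀ d, 3 / 4 * inner ℝ (A d) (T (A d)) ≤ (1 / τ - ε) * ‖d‖ ^ 2)
    (hsol : ∃ xs ys, IsKKT f A B b xs ys) :
    ∃ (xl : X) (yl : Y) (φ : ℕ → ℕ), Tendsto φ atTop atTop ∧
      Tendsto (fun j => x (φ j)) atTop (𝓝 xl) ∧ Tendsto (fun j => y (φ j)) atTop (𝓝 yl) ∧
      IsKKT f A B b xl yl := by
  obtain ⟨hd, -, hr⟩ := h.summable_steps hf hST hτ hθ hS hε hA hsol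
  obtain ⟨xs, ys, hs⟩ := hsol
  have hlow := lyapunov_lower_bound h.symm hST hτ hS hε hA
  have hanti := h.lyapunov_antitone hf hST hθ hS hε hA hs
  have hx0 : Tendsto (fun k => x (k + 1) - x k) atTop (𝓝 0) := tendsto_zero_of_summable_norm_sq hd
  have hr0 : Tendsto (fun k => A (x k) - b) atTop (𝓝 0) := tendsto_zero_of_summable_norm_sq hr
  set V₀ := lyapunov A S T τ (x 0 - xs) (y 0 - ys)
  have hV : ∀ k, 1 / (3 * τ) * ‖x k - xs‖ ^ 2 + θ * ‖y k - ys - T (A (x k - xs))‖ ^ 2 ≤ V₀ :=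
    fun k => (hlow _ _).trans (hanti (Nat.zero_le k))
  have hbx : ∀ k, ‖x k - xs‖ ≤ Real.sqrt (3 * τ * V₀) := fun k => by
    apply Real.le_sqrt_of_sq_le
    have h1 := hV k
    have h2 : 0 ≤ θ * ‖y k - ys - T (A (x k - xs))‖ ^ 2 := by positivity
    have h3 : 1 / (3 * τ) * ‖x k - xs‖ ^ 2 ≤ V₀ := by linarith
    rwa [one_div, inv_mul_le_iff₀ (by positivity)] at h3
  have hby : ∀ k, ‖y k - ys - T (A (x k - xs))‖ ≤ Real.sqrt (θ⁻¹ * V₀) := fun k => by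
    apply Real.le_sqrt_of_sq_le
    have h1 := hV k
    have h2 : 0 ≤ 1 / (3 * τ) * ‖x k - xs‖ ^ 2 := by positivity
    rw [le_inv_mul_iff₀ hθ]
    linarith
  have := FiniteDimensional.proper_real X
  have := FiniteDimensional.proper_real Y
  -- Compactness is applied to the shifted dual variable, the one the Lyapunov bound controls; the
  -- shift is continuous in `x` and is undone afterwards.
  obtain ⟨⟨u, v⟩, -, φ, hφ, huv⟩ := tendsto_subseq_of_bounded
    (Metric.isBounded_closedBall (x := (0 : X × Y))
      (r := max (Real.sqrt (3 * τ * V₀)) (Real.sqrt (θ⁻¹ * V₀))))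
    (x := fun k => (x k - xs, y k - ys - T (A (x k - xs)))) (fun k => by
      rw [mem_closedBall_zero_iff, Prod.norm_def]
      exact max_le_max (hbx k) (hby k))
  have hu : Tendsto (fun j => x (φ j)) atTop (𝓝 (u + xs)) := by
    have := ((continuous_fst.tendsto _).comp huv).add_const xs
    simpa [Function.comp_def] using this
  have hTA : Tendsto (fun j => T (A (x (φ j) - xs))) atTop (𝓝 (T (A (u + xs - xs)))) :=
    ((T.comp A).continuous.tendsto _).comp (hu.sub_const xs)
  have hv : Tendsto (fun j => y (φ j)) atTop (𝓝 (v + T (A (u + xs - xs)) + ys)) := by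
    have := (((continuous_snd.tendsto _).comp huv).add hTA).add_const ys
    simpa [Function.comp_def] using this
  set xl := u + xs
  set yl := v + T (A (xl - xs)) + ys
  refine ⟨xl, yl, φ, hφ.tendsto_atTop, hu, hv, ?_, ?_⟩
  · have h1 : Tendsto (fun j => A (x (φ j)) - b) atTop (𝓝 (A xl - b)) :=
      ((A.continuous.tendsto _).comp hu).sub_const b
    exact sub_eq_zero.1 (tendsto_nhds_unique h1 (hr0.comp hφ.tendsto_atTop))
  · have h1 : Tendsto (fun j => x (φ j + 1)) atTop (𝓝 xl) := by
      have := (hx0.comp hφ.tendsto_atTop).add hu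
      simpa [Function.comp_def] using this
    have h2 : Tendsto (fun j => -B (y (φ j)) - (1 / τ) • (x (φ j + 1) - x (φ j))) atTop
        (𝓝 (-B yl - (1 / τ) • (0 : X))) :=
      ((B.continuous.tendsto _).comp hv).neg.sub ((hx0.comp hφ.tendsto_atTop).const_smul _)
    rw [smul_zero, sub_zero] at h2
    exact subdifferential_closed hf h1 h2 (.of_forall fun j => h.subgradient (φ j))

theorem convergence (h : IsPrimalDualIteration f A B S b τ x y) (hf : IsProperClosedConvex f)
    (hτ : 0 < τ) (hθ : 0 < θ)
    (hS : ∀ u, 3 / 4 * τ * ‖B u‖ ^ 2 + θ * ‖u‖ ^ 2 ≤ inner ℝ (S u) u)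
    (hsol : ∃ xs ys, IsKKT f A B b xs ys) :
    (∃ xs ys, Tendsto x atTop (𝓝 xs) ∧ Tendsto y atTop (𝓝 ys) ∧ IsKKT f A B b xs ys) ∧
    (Summable fun k => ‖x (k + 1) - x k‖ ^ 2) ∧ (Summable fun k => ‖y (k + 1) - y k‖ ^ 2) ∧
    (Summable fun k => ‖A (x k) - b‖ ^ 2) := by
  have hS' : ∀ u, θ * ‖u‖ ^ 2 ≤ inner ℝ (S u) u := fun u =>
    (le_add_of_nonneg_left (by positivity)).trans (hS u)
  obtain ⟨T, hST⟩ := exists_inverse hθ hS'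
  obtain ⟨ε, hε, hA⟩ := exists_schur_bound h.adjoint hST hτ hθ hS
  refine ⟨?_, h.summable_steps hf hST hτ hθ hS' hε hA hsol⟩
  have hlow := lyapunov_lower_bound h.symm hST hτ hS' hε hA
  obtain ⟨xl, yl, φ, hφ, hu, hv, hkkt⟩ :=
    h.exists_subseq_tendsto_isKKT hf hST hτ hθ hS' hε hA hsol
  -- Recentred at the cluster point, itself a KKT point, the Lyapunov function is monotone and tends
  -- to `0` along a subsequence, hence along the whole sequence.
  have hlim : Tendsto (fun k => lyapunov A S T τ (x k - xl) (y k - yl)) atTop (𝓝 0) := by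
    refine (tendsto_iff_tendsto_subseq_of_antitone
      (h.lyapunov_antitone hf hST hθ hS' hε hA hkkt) hφ).2 ?_
    have hcont : Continuous fun q : X × Y => lyapunov A S T τ (q.1 - xl) (q.2 - yl) := by
      unfold lyapunov primalDualForm
      fun_prop
    have := (hcont.tendsto (xl, yl)).comp (hu.prodMk_nhds hv)
    simpa [lyapunov, primalDualForm, Function.comp_def] using this
  have hx1 : Tendsto (fun k => x k - xl) atTop (𝓝 0) := by
    refine tendsto_zero_of_norm_sq_le (c := 1 / (3 * τ)) (by positivity) (fun k => ?_) hlim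
    have h2 : 0 ≤ θ * ‖y k - yl - T (A (x k - xl))‖ ^ 2 := by positivity
    linarith [hlow (x k - xl) (y k - yl)]
  have hy1 : Tendsto (fun k => y k - yl - T (A (x k - xl))) atTop (𝓝 0) := by
    refine tendsto_zero_of_norm_sq_le hθ (fun k => ?_) hlim
    have h2 : 0 ≤ 1 / (3 * τ) * ‖x k - xl‖ ^ 2 := by positivity
    linarith [hlow (x k - xl) (y k - yl)]
  refine ⟨xl, yl, tendsto_sub_nhds_zero_iff.1 hx1, tendsto_sub_nhds_zero_iff.1 ?_, hkkt⟩
  have h3 : Tendsto (fun k => T (A (x k - xl))) atTop (𝓝 (T (A 0))) :=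
    ((T.comp A).continuous.tendsto _).comp hx1
  simpa using hy1.add h3

omit [FiniteDimensional ℝ X] [FiniteDimensional ℝ Y] in
theorem primalDualForm_step_antitone (h : IsPrimalDualIteration f A B S b τ x y)
    (hf : IsProperClosedConvex f) (hM : ∀ a p, 0 ≤ primalDualForm A S τ a p) :
    Antitone fun k => primalDualForm A S τ (x (k + 1) - x k) (y (k + 1) - y k) := by
  refine antitone_nat_of_succ_le fun k => ?_
  refine (primalDualForm_step (a := x (k + 1) - x k) (p := y (k + 1) - y k) h.adjoint h.symm ?_
    ?_).trans (sub_le_self _ (hM _ _))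
  · rw [map_sub S, h.dual, h.dual, sub_sub_sub_cancel_right, ← map_sub]
    congr 1
    module
  · have := subdifferential_mono hf (h.subgradient (k + 1)) (h.subgradient k)
    convert this using 2
    rw [map_sub, smul_sub]
    abel

omit [FiniteDimensional ℝ X] [FiniteDimensional ℝ Y] in
theorem rates (h : IsPrimalDualIteration f A B S b τ x y) (hf : IsProperClosedConvex f)
    (hτ : 0 < τ) (hθ : 0 < θ) (hS : ∀ u, τ * ‖B u‖ ^ 2 + θ * ‖u‖ ^ 2 ≤ inner ℝ (S u) u)
    (hd : Summable fun k => ‖x (k + 1) - x k‖ ^ 2)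
    (he : Summable fun k => ‖y (k + 1) - y k‖ ^ 2) :
    Tendsto (fun t : ℕ => (t : ℝ) * ‖x (t + 1) - x t‖ ^ 2) atTop (𝓝 0) ∧
    Tendsto (fun t : ℕ => (t : ℝ) * ‖y (t + 1) - y t‖ ^ 2) atTop (𝓝 0) ∧
    Tendsto (fun t : ℕ => (t : ℝ) * ‖A (x t) - b‖ ^ 2) atTop (𝓝 0) := by
  have hlow := primalDualForm_lower_bound h.adjoint hτ hS
  have hM : ∀ a p, 0 ≤ primalDualForm A S τ a p := fun a p => le_trans (by positivity) (hlow a p)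
  set N : ℕ → ℝ := fun k => primalDualForm A S τ (x (k + 1) - x k) (y (k + 1) - y k)
  have hN : Summable N :=
    (((hd.mul_left (1 / τ)).add (summable_norm_sq_clm A hd)).add
      (he.mul_left (1 + ‖S‖))).of_nonneg_of_le (fun _ => hM _ _) fun _ => primalDualForm_le _ _
  have ht := tendsto_mul_of_antitone_of_summable (fun _ => hM _ _)
    ((h.primalDualForm_step_antitone hf hM).antitoneOn _) hN
  have hy : Tendsto (fun t : ℕ => (t : ℝ) * ‖y (t + 1) - y t‖ ^ 2) atTop (𝓝 0) := by
    refine squeeze_zero (fun t => by positivity) (fun t => ?_)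
      (by simpa using ht.const_mul θ⁻¹)
    rw [le_inv_mul_iff₀ hθ, mul_left_comm]
    refine mul_le_mul_of_nonneg_left ?_ t.cast_nonneg
    refine le_trans ?_ (hlow _ _)
    exact le_add_of_nonneg_left (by positivity)
  -- The form controls the primal step only up to `τ B` of the dual step, which already has the
  -- rate.
  have hxy : Tendsto (fun t : ℕ => (t : ℝ) * ‖x (t + 1) - x t - τ • B (y (t + 1) - y t)‖ ^ 2)
      atTop (𝓝 0) := by
    refine squeeze_zero (fun t => by positivity) (fun t => ?_)
      (by simpa using ht.const_mul τ)
    have h1 : 1 / τ * ‖x (t + 1) - x t - τ • B (y (t + 1) - y t)‖ ^ 2 ≤ N t :=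
      le_trans (le_add_of_nonneg_right (by positivity)) (hlow _ _)
    rw [one_div, inv_mul_le_iff₀ hτ] at h1
    rw [mul_left_comm]
    exact mul_le_mul_of_nonneg_left h1 t.cast_nonneg
  have hx : Tendsto (fun t : ℕ => (t : ℝ) * ‖x (t + 1) - x t‖ ^ 2) atTop (𝓝 0) := by
    refine (tendsto_mul_norm_sq_add hxy (tendsto_mul_norm_sq_clm (τ • B) hy)).congr fun t => ?_
    rw [smul_apply, sub_add_cancel]
  refine ⟨hx, hy, tendsto_mul_norm_sq_of_succ ?_⟩
  -- By the dual equation, `S` of the dual step minus `A` of the primal step is the residual at `x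
  -- (t + 1)`.
  refine (tendsto_mul_norm_sq_add (tendsto_mul_norm_sq_clm S hy)
    (tendsto_mul_norm_sq_clm (-A) hx)).congr fun t => ?_
  rw [h.dual]
  congr 3
  simp only [map_sub, map_smul, neg_apply]
  module

end IsPrimalDualIteration

end Iteration

/-! ### Matrices acting on Euclidean spaces -/

section Act

variable {ι κ μ : Type*} [Fintype ι] [Fintype κ] [Fintype μ]

theorem inner_act (A : Matrix κ ι ℝ) (x : EuclideanSpace ℝ ι) (y : EuclideanSpace ℝ κ) :
    inner ℝ (act A x) y = inner ℝ x (act A.transpose y) := by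
  simp only [act, EuclideanSpace.inner_eq_star_dotProduct, star_trivial]
  rw [Matrix.dotProduct_mulVec, ← Matrix.mulVec_transpose, dotProduct_comm]

omit [Fintype κ] in
theorem act_add (A A' : Matrix κ ι ℝ) (x : EuclideanSpace ℝ ι) :
    act (A + A') x = act A x + act A' x := by
  simp [act, Matrix.add_mulVec]

omit [Fintype κ] in
theorem act_mul (A : Matrix κ ι ℝ) (A' : Matrix ι μ ℝ) (x : EuclideanSpace ℝ μ) :
    act (A * A') x = act A (act A' x) := by
  simp [act]

omit [Fintype κ] in
theorem act_smul_matrix (c : ℝ) (A : Matrix κ ι ℝ) (x : EuclideanSpace ℝ ι) :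
    act (c • A) x = c • act A x := by
  simp [act, Matrix.smul_mulVec]

theorem act_one [DecidableEq ι] (x : EuclideanSpace ℝ ι) : act (1 : Matrix ι ι ℝ) x = x := by
  simp [act]

/-- `act` as a continuous linear map. -/
def actCLM (A : Matrix κ ι ℝ) : EuclideanSpace ℝ ι →L[ℝ] EuclideanSpace ℝ κ :=
  LinearMap.toContinuousLinearMap
    { toFun := act A
      map_add' := fun x y => by simp [act, Matrix.mulVec_add]
      map_smul' := fun c x => by simp [act, Matrix.mulVec_smul] }

theorem actCLM_apply (A : Matrix κ ι ℝ) (x : EuclideanSpace ℝ ι) : actCLM A x = act A x := rfl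

end Act

/-! ### The operator of one symmetric Gauss–Seidel sweep -/

section Sweep

variable {s : ℕ} {m : Fin s → ℕ}
  {Q : Matrix ((i : Fin s) × Fin (m i)) ((i : Fin s) × Fin (m i)) ℝ}

/-- The inverse of the block diagonal part of `Q`. -/
def diagInv (Q : Matrix ((i : Fin s) × Fin (m i)) ((i : Fin s) × Fin (m i)) ℝ) :
    Matrix ((i : Fin s) × Fin (m i)) ((i : Fin s) × Fin (m i)) ℝ :=
  Matrix.blockDiagonal' fun i => (block Q i i)⁻¹

/-- `Q + U D⁻¹ Uᵀ`, the operator which a symmetric Gauss–Seidel sweep inverts. -/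
def sgsMatrix (Q : Matrix ((i : Fin s) × Fin (m i)) ((i : Fin s) × Fin (m i)) ℝ) :
    Matrix ((i : Fin s) × Fin (m i)) ((i : Fin s) × Fin (m i)) ℝ :=
  Q + strictUpper Q * (diagInv Q * (strictUpper Q).transpose)

theorem posDef_block (hQ : Q.PosDef) (i : Fin s) : (block Q i i).PosDef :=
  hQ.submatrix (sigma_mk_injective (i := i))

theorem strictUpper_mulVec (z : (i : Fin s) × Fin (m i) → ℝ) (i : Fin s) (a : Fin (m i)) :
    (strictUpper Q).mulVec z ⟨i, a⟩ = (∑ j ∈ Finset.univ.filter (fun j => i < j),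
      (block Q i j).mulVec (fun c => z ⟨j, c⟩)) a := by
  rw [Finset.sum_apply, Finset.sum_filter, Matrix.mulVec, dotProduct, Fintype.sum_sigma]
  refine Finset.sum_congr rfl fun j _ => ?_
  by_cases h : i < j <;> simp [h, strictUpper, block, Matrix.mulVec, dotProduct]

theorem strictUpper_transpose_mulVec (z : (i : Fin s) × Fin (m i) → ℝ) (i : Fin s)
    (a : Fin (m i)) :
    (strictUpper Q).transpose.mulVec z ⟨i, a⟩ = (∑ j ∈ Finset.univ.filter (fun j => j < i),
      (block Q j i).transpose.mulVec (fun c => z ⟨j, c⟩)) a := by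
  rw [Finset.sum_apply, Finset.sum_filter, Matrix.mulVec, dotProduct, Fintype.sum_sigma]
  refine Finset.sum_congr rfl fun j _ => ?_
  by_cases h : j < i <;> simp [h, strictUpper, block, Matrix.mulVec, dotProduct]

theorem blockDiagonal_mulVec (M : (i : Fin s) → Matrix (Fin (m i)) (Fin (m i)) ℝ)
    (z : (i : Fin s) × Fin (m i) → ℝ) (i : Fin s) (a : Fin (m i)) :
    (Matrix.blockDiagonal' M).mulVec z ⟨i, a⟩ = (M i).mulVec (fun c => z ⟨i, c⟩) a := by
  rw [Matrix.mulVec, dotProduct, Fintype.sum_sigma, Finset.sum_eq_single i]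
  · simp [Matrix.mulVec, dotProduct]
  · intro j _ hj
    refine Finset.sum_eq_zero fun c _ => ?_
    rw [Matrix.blockDiagonal'_apply_ne _ _ _ hj.symm, zero_mul]
  · simp

theorem eq_strictUpper_add_diag_add (hQ : Q.PosDef) :
    Q = strictUpper Q + Matrix.blockDiagonal' (fun i => block Q i i)
      + (strictUpper Q).transpose := by
  ext ⟨i, a⟩ ⟨j, c⟩
  have hs : Q ⟨j, c⟩ ⟨i, a⟩ = Q ⟨i, a⟩ ⟨j, c⟩ := by simpa using hQ.1.apply ⟨i, a⟩ ⟨j, c⟩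
  rcases lt_trichotomy i j with h | rfl | h
  · simp [strictUpper, h, h.not_gt, Matrix.blockDiagonal'_apply_ne _ _ _ h.ne]
  · simp [strictUpper, block]
  · simp [strictUpper, h, h.not_gt, Matrix.blockDiagonal'_apply_ne _ _ _ h.ne', hs]

theorem diagInv_mul_diag (hQ : Q.PosDef) :
    diagInv Q * Matrix.blockDiagonal' (fun i => block Q i i) = 1 := by
  rw [diagInv, ← Matrix.blockDiagonal'_mul, ← Matrix.blockDiagonal'_one]
  congr 1
  funext i
  exact Matrix.nonsing_inv_mul _ ((Matrix.isUnit_iff_isUnit_det _).1 (posDef_block hQ i).isUnit)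

/-- With `ω` the backward and `δ` the final increment, the sweeps read `(D + U) ω = c` and `(D + Uᵀ)
δ + U ω = c`. Subtracting gives `ω = δ + D⁻¹ Uᵀ δ`, and substitution yields `(Q + U D⁻¹ Uᵀ) δ = c`.
-/
theorem IsSGSSweep.act_sgsMatrix (hQ : Q.PosDef)
    {c y y' : EuclideanSpace ℝ ((i : Fin s) × Fin (m i))} (h : IsSGSSweep Q c y y') :
    act (sgsMatrix Q) (y' - y) = c := by
  obtain ⟨w, hw, hy⟩ := h
  set U := strictUpper Q
  set D := Matrix.blockDiagonal' (fun i => block Q i i)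
  set δ : (i : Fin s) × Fin (m i) → ℝ := (y' - y).ofLp
  set rhs : (i : Fin s) → Fin (m i) → ℝ := fun i => blockVec c i
    - ∑ j ∈ Finset.univ.filter (fun j => i < j), (block Q i j).mulVec (blockVec w j - blockVec y j)
    with hrhs
  -- The first block of `w` is unconstrained, so `ω` extends the backward formula to it; this is
  -- harmless because `U` never reads that block.
  set ω : (i : Fin s) × Fin (m i) → ℝ := fun p => ((block Q p.1 p.1)⁻¹.mulVec (rhs p.1)) p.2
    with hω
  have hωw : ∀ j : Fin s, 0 < j.val → (fun a => ω ⟨j, a⟩) = blockVec w j - blockVec y j := by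
    intro j hj
    rw [hw j hj, add_sub_cancel_left]
  have hUω : ∀ i a, U.mulVec ω ⟨i, a⟩ = (∑ j ∈ Finset.univ.filter (fun j => i < j),
      (block Q i j).mulVec (blockVec w j - blockVec y j)) a := by
    intro i a
    rw [strictUpper_mulVec]
    refine congrFun (Finset.sum_congr rfl fun j hj => ?_) a
    have hij : i < j := (Finset.mem_filter.1 hj).2
    rw [hωw j (lt_of_le_of_lt (Nat.zero_le _) hij)]
  have hinv : ∀ i, block Q i i * (block Q i i)⁻¹ = 1 := fun i =>
    Matrix.mul_nonsing_inv _ ((Matrix.isUnit_iff_isUnit_det _).1 (posDef_block hQ i).isUnit)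
  have hDω : D.mulVec ω + U.mulVec ω = c.ofLp := by
    ext ⟨i, a⟩
    rw [Pi.add_apply, blockDiagonal_mulVec, hUω]
    change ((block Q i i).mulVec ((block Q i i)⁻¹.mulVec (rhs i))) a + _ = _
    rw [Matrix.mulVec_mulVec, hinv, Matrix.one_mulVec, hrhs]
    simp [blockVec]
  have hDδ : D.mulVec δ + U.transpose.mulVec δ + U.mulVec ω = c.ofLp := by
    ext ⟨i, a⟩
    have h1 : (fun a => δ ⟨i, a⟩) = blockVec y' i - blockVec y i := rfl
    rw [Pi.add_apply, Pi.add_apply, blockDiagonal_mulVec, hUω, strictUpper_transpose_mulVec, h1,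
      hy i, add_sub_cancel_left, Matrix.mulVec_mulVec, hinv, Matrix.one_mulVec]
    have h2 : ∀ j, (fun a => δ ⟨j, a⟩) = blockVec y' j - blockVec y j := fun j => rfl
    simp only [h2, Pi.sub_apply, blockVec]
    ring
  have h1 : D.mulVec ω = D.mulVec δ + U.transpose.mulVec δ :=
    add_right_cancel (hDω.trans hDδ.symm)
  have h2 : ω = δ + (diagInv Q).mulVec (U.transpose.mulVec δ) := by
    have := congrArg (fun v => (diagInv Q).mulVec v) h1
    rwa [Matrix.mulVec_add, Matrix.mulVec_mulVec, Matrix.mulVec_mulVec, diagInv_mul_diag hQ,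
      Matrix.one_mulVec, Matrix.one_mulVec] at this
  have h3 : (sgsMatrix Q).mulVec δ = c.ofLp := by
    rw [← hDδ, h2, sgsMatrix, Matrix.add_mulVec, ← Matrix.mulVec_mulVec, ← Matrix.mulVec_mulVec,
      Matrix.mulVec_add]
    have hQδ : Q.mulVec δ = U.mulVec δ + D.mulVec δ + U.transpose.mulVec δ := by
      rw [← Matrix.add_mulVec, ← Matrix.add_mulVec, ← eq_strictUpper_add_diag_add hQ]
    rw [hQδ]
    abel
  rw [act, h3]

theorem diagInv_transpose (hQ : Q.PosDef) : (diagInv Q).transpose = diagInv Q := by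
  rw [diagInv, Matrix.blockDiagonal'_transpose]
  congr 1
  funext i
  have := (posDef_block hQ i).inv.1
  rwa [Matrix.IsHermitian, Matrix.conjTranspose_eq_transpose_of_trivial] at this

theorem sgsMatrix_transpose (hQ : Q.PosDef) : (sgsMatrix Q).transpose = sgsMatrix Q := by
  have h := hQ.1
  rw [Matrix.IsHermitian, Matrix.conjTranspose_eq_transpose_of_trivial] at h
  rw [sgsMatrix, Matrix.transpose_add, Matrix.transpose_mul, Matrix.transpose_mul,
    Matrix.transpose_transpose, diagInv_transpose hQ, h, Matrix.mul_assoc]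

theorem inner_diagInv_nonneg (hQ : Q.PosDef) (z : EuclideanSpace ℝ ((i : Fin s) × Fin (m i))) :
    0 ≤ inner ℝ (act (diagInv Q) z) z := by
  rw [act, EuclideanSpace.inner_eq_star_dotProduct, star_trivial, dotProduct, Fintype.sum_sigma]
  refine Finset.sum_nonneg fun i _ => ?_
  have := (posDef_block hQ i).inv.posSemidef.dotProduct_mulVec_nonneg (blockVec z i)
  rw [star_trivial, dotProduct] at this
  refine this.trans_eq (Finset.sum_congr rfl fun a _ => ?_)
  exact congrArg (z ⟨i, a⟩ * ·)
    (blockDiagonal_mulVec (fun i => (block Q i i)⁻¹) z.ofLp i a).symm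

theorem le_inner_sgsMatrix (hQ : Q.PosDef) (u : EuclideanSpace ℝ ((i : Fin s) × Fin (m i))) :
    inner ℝ (act Q u) u ≤ inner ℝ (act (sgsMatrix Q) u) u := by
  rw [sgsMatrix, act_add, inner_add_left, act_mul, act_mul, inner_act (strictUpper Q)]
  exact le_add_of_nonneg_right (inner_diagInv_nonneg hQ _)

theorem posDef_dualMatrix {n : ℕ} (K : Matrix ((i : Fin s) × Fin (m i)) (Fin n) ℝ) {τ γ θ : ℝ}
    (hγτ : 0 ≤ γ * τ) (hθ : 0 < θ) : (dualMatrix K τ γ θ).PosDef := by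
  have h1 : (K * K.transpose).PosSemidef := by
    simpa using Matrix.posSemidef_self_mul_conjTranspose K
  exact Matrix.PosDef.posSemidef_add (h1.smul hγτ) (Matrix.PosDef.one.smul hθ)

theorem inner_dualMatrix {n : ℕ} (K : Matrix ((i : Fin s) × Fin (m i)) (Fin n) ℝ) (τ γ θ : ℝ)
    (u : EuclideanSpace ℝ ((i : Fin s) × Fin (m i))) :
    inner ℝ (act (dualMatrix K τ γ θ) u) u = γ * τ * ‖act K.transpose u‖ ^ 2 + θ * ‖u‖ ^ 2 := by
  rw [dualMatrix, act_add, act_smul_matrix, act_smul_matrix, act_mul, act_one, inner_add_left,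
    inner_smul_left, inner_smul_left, inner_act, real_inner_self_eq_norm_sq,
    real_inner_self_eq_norm_sq]
  rfl

end Sweep

/-! ### Saddle points and residuals -/

section Problem

variable {ι κ : Type*} [Fintype ι] [Fintype κ] {f : EuclideanSpace ℝ ι → EReal}
  {K : Matrix κ ι ℝ} {b : EuclideanSpace ℝ κ} {x : EuclideanSpace ℝ ι} {y : EuclideanSpace ℝ κ}

theorem IsSaddlePoint.isKKT (hf : IsProperClosedConvex f) (h : IsSaddlePoint f K b x y) :
    IsKKT f (actCLM K) (actCLM K.transpose) b x y := by
  have h' : ∀ z v, lagrangian f K b x v ≤ lagrangian f K b z y := fun z v =>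
    h z (Set.mem_univ _) v (Set.mem_univ _)
  have hx : f x ≠ ⊤ := by
    intro hx
    obtain ⟨z, hz⟩ := hf.exists_ne_top
    obtain ⟨c, hc⟩ := hf.exists_coe hz
    have := h' z y
    rw [lagrangian, lagrangian, hx, hc, EReal.top_add_coe, ← EReal.coe_add, top_le_iff] at this
    exact EReal.coe_ne_top _ this
  obtain ⟨a, ha⟩ := hf.exists_coe hx
  constructor
  -- Moving the multiplier along the residual raises the Lagrangian by `‖K x - b‖²`, so maximality
  -- in `y` forces feasibility.
  · have h1 := h' x (y + (act K x - b))
    rw [lagrangian, lagrangian, ha] at h1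
    norm_cast at h1
    rw [inner_add_left, inner_add_right, real_inner_comm (act K x - b) b] at h1
    have h2 : inner ℝ (act K x - b) (act K x - b) =
      inner ℝ (act K x - b) (act K x) - inner ℝ (act K x - b) b := inner_sub_right _ _ _
    have h3 : inner ℝ (act K x - b) (act K x - b) = 0 :=
      le_antisymm (by linarith) real_inner_self_nonneg
    exact sub_eq_zero.1 (inner_self_eq_zero.1 h3)
  · refine ⟨hx, fun z => ?_⟩
    by_cases hz : f z = ⊤
    · rw [hz]; exact le_top
    obtain ⟨c, hc⟩ := hf.exists_coe hz
    have h1 := h' z y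
    rw [lagrangian, lagrangian, ha, hc] at h1
    rw [ha, hc]
    norm_cast at h1 ⊢
    rw [actCLM_apply, inner_neg_left, real_inner_comm, ← inner_act, ← actCLM_apply, map_sub,
      inner_sub_left, actCLM_apply, actCLM_apply, real_inner_comm, real_inner_comm y (act K x)]
    linarith

theorem IsKKT.isSaddlePoint (hf : IsProperClosedConvex f)
    (h : IsKKT f (actCLM K) (actCLM K.transpose) b x y) : IsSaddlePoint f K b x y := by
  obtain ⟨h1, hx, h2⟩ := h
  rw [actCLM_apply] at h1
  intro z _ v _
  obtain ⟨a, ha⟩ := hf.exists_coe hx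
  by_cases hz : f z = ⊤
  · rw [lagrangian, lagrangian, hz, EReal.top_add_coe]; exact le_top
  obtain ⟨c, hc⟩ := hf.exists_coe hz
  have h3 := h2 z
  rw [ha, hc] at h3
  rw [lagrangian, lagrangian, ha, hc]
  norm_cast at h3 ⊢
  rw [actCLM_apply, inner_neg_left, real_inner_comm, ← inner_act, ← actCLM_apply, map_sub,
    inner_sub_left, actCLM_apply, actCLM_apply, h1, real_inner_comm] at h3
  rw [h1, real_inner_comm v b]
  linarith

theorem IsKKT.isOptimalSolution
    (h : IsKKT f (actCLM K) (actCLM K.transpose) b x y) : IsOptimalSolution f K b x := by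
  obtain ⟨h1, hx, h2⟩ := h
  rw [actCLM_apply] at h1
  refine ⟨h1, hx, fun z hz => ?_⟩
  have h3 := h2 z
  rw [actCLM_apply, inner_neg_left, real_inner_comm, ← inner_act, ← actCLM_apply, map_sub,
    actCLM_apply, actCLM_apply, h1, hz] at h3
  simpa using h3

theorem dualResidual_nonneg : 0 ≤ dualResidual f K x y := Metric.infDist_nonneg

theorem dualResidual_le {ξ : EuclideanSpace ℝ ι} (hξ : ξ ∈ subdifferential f x) :
    dualResidual f K x y ≤ ‖ξ + act K.transpose y‖ := by
  have : ξ + act K.transpose y ∈ dualResidualSet f K x y := ⟨ξ, hξ, rfl⟩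
  simpa [dualResidual] using Metric.infDist_le_dist_of_mem (x := 0) this

end Problem

section Residuals

variable {n s : ℕ} {m : Fin s → ℕ} {f : EuclideanSpace ℝ (Fin n) → EReal}
  {K : Matrix ((i : Fin s) × Fin (m i)) (Fin n) ℝ}
  {b : EuclideanSpace ℝ ((i : Fin s) × Fin (m i))} {τ γ θ : ℝ}
  {x : ℕ → EuclideanSpace ℝ (Fin n)} {y : ℕ → EuclideanSpace ℝ ((i : Fin s) × Fin (m i))}

theorem IsEBALMsGS.isPrimalDualIteration (hxy : IsEBALMsGS f K b τ γ θ x y)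
    (hf : IsProperClosedConvex f) (hτ : 0 < τ) (hγ : 0 ≤ γ) (hθ : 0 < θ) :
    IsPrimalDualIteration f (actCLM K) (actCLM K.transpose)
      (actCLM (sgsMatrix (dualMatrix K τ γ θ))) b τ x y where
  adjoint := inner_act K
  symm u v := by
    have := inner_act (sgsMatrix (dualMatrix K τ γ θ)) u v
    rwa [sgsMatrix_transpose (posDef_dualMatrix K (mul_nonneg hγ hτ.le) hθ)] at this
  subgradient k := by
    have := (hxy k).1.mem_subdifferential hf hτ
    convert this using 1
    have h1 : (1 / τ) • (τ • act K.transpose (y k)) = act K.transpose (y k) := by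
      rw [smul_smul, one_div_mul_cancel hτ.ne', one_smul]
    rw [actCLM_apply, sub_right_comm, smul_sub _ _ (τ • act K.transpose (y k)), h1]
    module
  dual k := (hxy k).2.act_sgsMatrix (posDef_dualMatrix K (mul_nonneg hγ hτ.le) hθ)

/-- The proximal step supplies the explicit subgradient `-Kᵀ y k - (x (k + 1) - x k)/τ`, so the
distance is bounded by a linear image of the steps. -/
theorem IsPrimalDualIteration.dualResidual_current_le
    {S : EuclideanSpace ℝ ((i : Fin s) × Fin (m i)) →L[ℝ] EuclideanSpace ℝ ((i : Fin s) × Fin (m i))}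
    (h : IsPrimalDualIteration f (actCLM K) (actCLM K.transpose) S b τ x y) (k : ℕ) :
    dualResidual f K (x (k + 1)) (y (k + 1)) ≤
      ‖(-(1 / τ) • ContinuousLinearMap.id ℝ _) (x (k + 1) - x k)
        + actCLM K.transpose (y (k + 1) - y k)‖ := by
  refine (dualResidual_le (h.subgradient k)).trans_eq ?_
  rw [← actCLM_apply, map_sub (actCLM K.transpose), smul_apply, ContinuousLinearMap.id_apply]
  congr 1
  module

theorem IsPrimalDualIteration.dualResidual_previous_le
    {S : EuclideanSpace ℝ ((i : Fin s) × Fin (m i)) →L[ℝ] EuclideanSpace ℝ ((i : Fin s) × Fin (m i))}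
    (h : IsPrimalDualIteration f (actCLM K) (actCLM K.transpose) S b τ x y) (k : ℕ) :
    dualResidual f K (x (k + 1)) (y k) ≤
      ‖(-(1 / τ) • ContinuousLinearMap.id ℝ _) (x (k + 1) - x k)‖ := by
  refine (dualResidual_le (h.subgradient k)).trans_eq ?_
  rw [← actCLM_apply, smul_apply, ContinuousLinearMap.id_apply]
  congr 1
  module

end Residuals

/-! ### Transfer of rates from steps to residuals, and the main theorem. -/

theorem bestIterate_isLittleO_of_succ_le {E : Type*} [NormedAddCommGroup E] {r : ℕ → ℝ} {u : ℕ → E}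
    (hr : ∀ k, 0 ≤ r k) (hu : ∀ k, r (k + 1) ≤ ‖u k‖) (hs : Summable fun k => ‖u k‖ ^ 2) :
    bestIterate r =o[atTop] fun t : ℕ => 1 / Real.sqrt t :=
  bestIterate_isLittleO hr <| (summable_nat_add_iff 1).1 <|
    hs.of_nonneg_of_le (fun _ => sq_nonneg _) fun k => pow_le_pow_left₀ (hr _) (hu k) 2

theorem isLittleO_of_succ_le {E : Type*} [NormedAddCommGroup E] {r : ℕ → ℝ} {u : ℕ → E}
    (hr : ∀ k, 0 ≤ r k) (hu : ∀ k, r (k + 1) ≤ ‖u k‖)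
    (ht : Tendsto (fun t : ℕ => (t : ℝ) * ‖u t‖ ^ 2) atTop (𝓝 0)) :
    r =o[atTop] fun t : ℕ => 1 / Real.sqrt t := by
  have h : Tendsto (fun t : ℕ => (t : ℝ) * ‖r (t + 1)‖ ^ 2) atTop (𝓝 0) := by
    refine squeeze_zero (fun t => by positivity) (fun t => ?_) ht
    rw [Real.norm_of_nonneg (hr _)]
    exact mul_le_mul_of_nonneg_left (pow_le_pow_left₀ (hr _) (hu t) 2) t.cast_nonneg
  refine isLittleO_one_div_sqrt ((tendsto_mul_norm_sq_of_succ h).congr fun t => ?_)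
  rw [Real.norm_of_nonneg (hr _)]

end EBALM

end

theorem lemma4p1 {n s : ℕ} {m : Fin s → ℕ}
    (f : EuclideanSpace ℝ (Fin n) → EReal) (hf : EBALM.IsProperClosedConvex f)
    (K : Matrix ((i : Fin s) × Fin (m i)) (Fin n) ℝ)
    (b : EuclideanSpace ℝ ((i : Fin s) × Fin (m i)))
    (hsaddle : ∃ xs ys, EBALM.IsSaddlePoint f K b xs ys)
    (τ γ θ : ℝ) (hτ : 0 < τ) (hθ : 0 < θ) (hγ : 3 / 4 ≤ γ)
    (hU : EBALM.strictUpper (EBALM.dualMatrix K τ γ θ) ≠ 0)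
    (x : ℕ → EuclideanSpace ℝ (Fin n))
    (y : ℕ → EuclideanSpace ℝ ((i : Fin s) × Fin (m i)))
    (hxy : EBALM.IsEBALMsGS f K b τ γ θ x y) :
    (∃ xs ys, Tendsto x atTop (𝓝 xs) ∧ Tendsto y atTop (𝓝 ys) ∧
      EBALM.IsOptimalSolution f K b xs ∧ EBALM.IsSaddlePoint f K b xs ys) ∧
    (∀ k : ℕ, 1 ≤ k → (EBALM.subdifferential f (x k)).Nonempty) ∧
    ((EBALM.bestIterate fun k => EBALM.dualResidual f K (x k) (y k))
        =o[atTop] fun t : ℕ => 1 / Real.sqrt t) ∧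
    ((EBALM.bestIterate fun k => EBALM.dualResidual f K (x k) (y (k - 1)))
        =o[atTop] fun t : ℕ => 1 / Real.sqrt t) ∧
    ((EBALM.bestIterate fun k => ‖EBALM.act K (x k) - b‖)
        =o[atTop] fun t : ℕ => 1 / Real.sqrt t) ∧
    (1 ≤ γ →
      ((fun t : ℕ => EBALM.dualResidual f K (x t) (y t))
          =o[atTop] fun t : ℕ => 1 / Real.sqrt t) ∧
      ((fun t : ℕ => EBALM.dualResidual f K (x t) (y (t - 1)))
          =o[atTop] fun t : ℕ => 1 / Real.sqrt t) ∧
      ((fun t : ℕ => ‖EBALM.act K (x t) - b‖)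
          =o[atTop] fun t : ℕ => 1 / Real.sqrt t)) := by
  have hγ0 : 0 ≤ γ := by linarith
  have hit := hxy.isPrimalDualIteration hf hτ hγ0 hθ
  have hQ := EBALM.posDef_dualMatrix K (mul_nonneg hγ0 hτ.le) hθ
  -- Needed with `g = 3/4` for convergence and with `g = 1` for the last-iterate rates.
  have hlow : ∀ {g : ℝ}, g ≤ γ → ∀ u, g * τ * ‖EBALM.actCLM K.transpose u‖ ^ 2 + θ * ‖u‖ ^ 2 ≤
      inner ℝ (EBALM.actCLM (EBALM.sgsMatrix (EBALM.dualMatrix K τ γ θ)) u) u := by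
    intro g hg u
    refine le_trans ?_ (EBALM.le_inner_sgsMatrix hQ u)
    rw [EBALM.inner_dualMatrix, EBALM.actCLM_apply]
    gcongr
  obtain ⟨xs, ys, hs⟩ := hsaddle
  obtain ⟨⟨xl, yl, hx, hy, hkkt⟩, hd, he, hr⟩ :=
    hit.convergence hf hτ hθ (hlow hγ) ⟨xs, ys, hs.isKKT hf⟩
  refine ⟨⟨xl, yl, hx, hy, hkkt.isOptimalSolution, hkkt.isSaddlePoint hf⟩, ?_, ?_, ?_, ?_, ?_⟩
  · intro k hk
    obtain ⟨j, rfl⟩ := Nat.exists_eq_add_of_le' hk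
    exact ⟨_, hit.subgradient j⟩
  · exact EBALM.bestIterate_isLittleO_of_succ_le (fun _ => EBALM.dualResidual_nonneg)
      hit.dualResidual_current_le
      (EBALM.summable_norm_sq_add (EBALM.summable_norm_sq_clm _ hd)
        (EBALM.summable_norm_sq_clm _ he))
  · exact EBALM.bestIterate_isLittleO_of_succ_le (fun _ => EBALM.dualResidual_nonneg)
      hit.dualResidual_previous_le (EBALM.summable_norm_sq_clm _ hd)
  · exact EBALM.bestIterate_isLittleO (fun _ => norm_nonneg _) hr
  · intro hγ1
    obtain ⟨hd', he', hr'⟩ := hit.rates hf hτ hθ (by simpa using hlow hγ1) hd he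
    refine ⟨?_, ?_, EBALM.isLittleO_one_div_sqrt hr'⟩
    · exact EBALM.isLittleO_of_succ_le (fun _ => EBALM.dualResidual_nonneg)
        hit.dualResidual_current_le
        (EBALM.tendsto_mul_norm_sq_add (EBALM.tendsto_mul_norm_sq_clm _ hd')
          (EBALM.tendsto_mul_norm_sq_clm _ he'))
    · exact EBALM.isLittleO_of_succ_le (fun _ => EBALM.dualResidual_nonneg)
        hit.dualResidual_previous_le (EBALM.tendsto_mul_norm_sq_clm _ hd')
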